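/- Let $q$ be a prime power. For $n\ge 0$ let $E(q,n)$ be the set of all linear subspaces of $\mathrm{GF}(q)^n$, with the injection metric $$d_I(U,V)=\max\{\dim U,\dim V\}-\dim(U\cap V)=\tfrac12\bigl(\dim(U+V)-\dim(U\cap V)\bigr)+\tfrac12\,|\dim U-\dim V| .$$ Let $A_I(q,n,d)$ be the maximum cardinality of a nonempty set $\mathcal C\subseteq E(q,n)$ whose distinct elements are pairwise at injection distance at least $d$. For $0\le r\le n$ let $A_C(q,n,r,d)$ be the maximum cardinality of such a set all of whose elements have dimension $r$ (a constant-dimension code, CDC). (1) For $0\le d'\le 1$ put $$a_I(d')=\limsup_{n\to\infty}\frac{\log_q A_I(q,n,\lceil nd'\rceil)}{\log_q|E(q,n)|}.$$ Then $a_I(d')=1-2d'$ if $0\le d'\le \frac12$, and $a_I(d')=0$ if $\frac12\le d'\le 1$. (2) Let $0\le r'\le 1$ and $0\le d'\le 1$. Let $N\subseteq\mathbb N$ be an infinite set of lengths, and for $n\in N$ let $r_n\in\{0,\dots,n\}$ be such that $r_n/n\to r'$ as $n\to\infty$, $n\in N$. (For example, $N=\mathbb N$ and $r_n=\lfloor nr'\rfloor$;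 or $r_n=nr'$ with $N$ the set of all $n$ such that $nr'$ is an integer, if this set is infinite.) Put $$a_I(r',d')=\limsup_{n\to\infty,\ n\in N}\frac{\log_q A_C(q,n,r_n,\lceil nd'\rceil)}{\log_q|E(q,n)|}.$$ Then, independently of the choice of $N$ and $(r_n)$, - $a_I(r',d')=0$ if $0\le r'\le d'$ or $1-d'\le r'\le 1$; - $a_I(r',d')=4(1-r')(r'-d')$ if $d'\le r'\le \frac12$; - $a_I(r',d')=4r'(1-r'-d')$ if $\frac12\le r'\le 1-d'$. -/

import Mathlib

open Filter Topology

namespace SubspaceCode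

/-- The projective space `E(q,n)`: the set of all subspaces of `GF(q)^n`, where `F = GF(q)`. -/
abbrev ProjSpace (F : Type*) [Field F] (n : ℕ) : Type _ := Submodule F (Fin n → F)

/-- The injection metric `max {dim U, dim V} - dim (U ∩ V)`. (The subtraction never truncates;
`injDist_eq` below is the other usual formula.) -/
noncomputable def injDist {F : Type*} [Field F] {n : ℕ} (U V : ProjSpace F n) : ℕ :=
  max (Module.finrank F U) (Module.finrank F V) - Module.finrank F (U ⊓ V : ProjSpace F n)

/-- The subspace metric `dim (U + V) - dim (U ∩ V)`. -/
noncomputable def subDist {F : Type*} [Field F] {n : ℕ} (U V : ProjSpace F n) : ℕ :=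
  Module.finrank F (U ⊔ V : ProjSpace F n) - Module.finrank F (U ⊓ V : ProjSpace F n)

theorem injDist_eq {F : Type*} [Field F] {n : ℕ} (U V : ProjSpace F n) :
    (injDist U V : ℝ) = (1 / 2) * (subDist U V : ℝ)
      + (1 / 2) * |(Module.finrank F U : ℝ) - (Module.finrank F V : ℝ)| := by
  have h := Submodule.finrank_sup_add_finrank_inf_eq U V
  have h1 : Module.finrank F (U ⊓ V : ProjSpace F n) ≤ Module.finrank F U :=
    Submodule.finrank_mono inf_le_left
  have h2 : Module.finrank F (U ⊓ V : ProjSpace F n) ≤ Module.finrank F V :=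
    Submodule.finrank_mono inf_le_right
  have h3 : Module.finrank F (U ⊓ V : ProjSpace F n)
      ≤ Module.finrank F (U ⊔ V : ProjSpace F n) :=
    Submodule.finrank_mono (inf_le_left.trans le_sup_left)
  unfold injDist subDist
  rw [Nat.cast_sub (h1.trans (le_max_left _ _)), Nat.cast_sub h3, Nat.cast_max]
  have h' : (Module.finrank F (U ⊔ V : ProjSpace F n) : ℝ)
      + Module.finrank F (U ⊓ V : ProjSpace F n)
      = Module.finrank F U + Module.finrank F V := by exact_mod_cast h
  rcases le_total (Module.finrank F U : ℝ) (Module.finrank F V) with h4 | h4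
  · rw [max_eq_right h4, abs_of_nonpos (by linarith)]
    linarith
  · rw [max_eq_left h4, abs_of_nonneg (by linarith)]
    linarith

/-- A subspace code (a nonempty set of subspaces) with minimum injection distance `d`:
any two distinct codewords are at injection distance at least `d`. -/
def IsCode {F : Type*} [Field F] {n : ℕ} (d : ℕ) (C : Set (ProjSpace F n)) : Prop :=
  C.Nonempty ∧ ∀ U ∈ C, ∀ V ∈ C, U ≠ V → d ≤ injDist U V

/-- `A_I(q,n,d)`: the maximum cardinality of a code in `E(q,n)` with minimum injection
distance `d`. -/
noncomputable def maxCode (F : Type*) [Field F] (n d : ℕ) : ℕ :=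
  sSup {m : ℕ | ∃ C : Set (ProjSpace F n), IsCode d C ∧ C.ncard = m}

/-- `A_C(q,n,r,d)`: the maximum cardinality of a constant-dimension code of dimension `r` in
`E(q,n)` with minimum injection distance `d`. -/
noncomputable def maxCDC (F : Type*) [Field F] (n r d : ℕ) : ℕ :=
  sSup {m : ℕ | ∃ C : Set (ProjSpace F n),
    IsCode d C ∧ (∀ U ∈ C, Module.finrank F U = r) ∧ C.ncard = m}

/-- The supremum in `maxCode` is a maximum. -/
theorem isGreatest_maxCode (F : Type*) [Field F] [Finite F] (n d : ℕ) :
    IsGreatest {m : ℕ | ∃ C : Set (ProjSpace F n), IsCode d C ∧ C.ncard = m}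
      (maxCode F n d) := by
  have hb : BddAbove {m : ℕ | ∃ C : Set (ProjSpace F n), IsCode d C ∧ C.ncard = m} := by
    refine ⟨Nat.card (ProjSpace F n), ?_⟩
    rintro _ ⟨C, -, rfl⟩
    exact Set.ncard_le_card C
  refine ⟨Nat.sSup_mem ⟨_, {⊥}, ⟨Set.singleton_nonempty _, ?_⟩, rfl⟩ hb, fun m hm => le_csSup hb hm⟩
  rintro U rfl V rfl h
  exact absurd rfl h

/-- The supremum in `maxCDC` is a maximum. -/
theorem isGreatest_maxCDC (F : Type*) [Field F] [Finite F] (n r d : ℕ) (hr : r ≤ n) :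
    IsGreatest {m : ℕ | ∃ C : Set (ProjSpace F n),
      IsCode d C ∧ (∀ U ∈ C, Module.finrank F U = r) ∧ C.ncard = m} (maxCDC F n r d) := by
  have hb : BddAbove {m : ℕ | ∃ C : Set (ProjSpace F n),
      IsCode d C ∧ (∀ U ∈ C, Module.finrank F U = r) ∧ C.ncard = m} := by
    refine ⟨Nat.card (ProjSpace F n), ?_⟩
    rintro _ ⟨C, -, -, rfl⟩
    exact Set.ncard_le_card C
  obtain ⟨v, hv⟩ := exists_linearIndependent_of_le_finrank (R := F) (M := Fin n → F) (n := r)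
    (by simpa using hr)
  obtain ⟨W, hW⟩ : ∃ W : ProjSpace F n, Module.finrank F W = r :=
    ⟨Submodule.span F (Set.range v), by simpa using finrank_span_eq_card hv⟩
  refine ⟨Nat.sSup_mem ⟨_, {W}, ⟨Set.singleton_nonempty _, ?_⟩, ?_, rfl⟩ hb,
    fun m hm => le_csSup hb hm⟩
  · rintro U rfl V rfl h
    exact absurd rfl h
  · rintro U rfl
    exact hW

/-- The rate `log_q A / log_q |E(q,n)|` of a code of cardinality `A` in `E(q,n)`. -/
noncomputable def rate (F : Type*) [Field F] (n A : ℕ) : ℝ :=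
  Real.logb (Nat.card F) A / Real.logb (Nat.card F) (Nat.card (ProjSpace F n))

/-- `a_I(d') = limsup_n log_q A_I(q,n,⌈n d'⌉) / log_q |E(q,n)|`. The upper limit is taken in the
extended reals, where it always exists. -/
noncomputable def asympRate (F : Type*) [Field F] (d' : ℝ) : EReal :=
  limsup (fun n : ℕ => ((rate F n (maxCode F n ⌈(n : ℝ) * d'⌉₊) : ℝ) : EReal)) atTop

/-- The asymptotic rate `limsup log_q A_C(q,n,r_n,⌈n d'⌉) / log_q |E(q,n)|` of constant-dimension
codes of dimensions `r n`, as `n` tends to infinity within the set `N` of lengths. -/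
noncomputable def asympRateCDC (F : Type*) [Field F] (N : Set ℕ) (r : ℕ → ℕ) (d' : ℝ) : EReal :=
  limsup (fun n : ℕ => ((rate F n (maxCDC F n (r n) ⌈(n : ℝ) * d'⌉₊) : ℝ) : EReal))
    (atTop ⊓ 𝓟 N)

end SubspaceCode

/-! A family of `r`-dimensional subspaces of `F ^ (r + s)` with pairwise intersections of dimension
less than `k` has at most about `q ^ (s * k)` members, because no linearly independent `k`-tuple
lies in two of them; for `r ≤ s`, the graphs of the maps `F ^ r → F ^ s` in a linear Gabidulin code
reach this order of magnitude. Orthogonal complements exchange the dimensions `r` and `s`, so that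
`log_q A_C(q, n, r, d)` is `max r s * (min r s - d)` up to an error linear in `n = r + s`. A code
of mixed dimensions is at most `n + 1` times as large as its largest constant-dimension part, and
`max r s * (min r s - d)` is largest for `r` close to `n / 2`. With `d = 0` this also gives
`log_q |E(q, n)| ∼ n ^ 2 / 4`. -/

namespace SubspaceCode

section Packing

variable {F V : Type*} [Field F] [Finite F] [AddCommGroup V] [Module F V]

theorem pow_le_pow_mul_ncard_linearIndependent (U : Submodule F V) [FiniteDimensional F U]
    {k : ℕ} (hk : k ≤ Module.finrank F U) :
    Nat.card F ^ (Module.finrank F U * k) ≤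
      Nat.card F ^ k * {v : Fin k → V | LinearIndependent F v ∧ ∀ i, v i ∈ U}.ncard := by
  have : Fintype F := Fintype.ofFinite F
  have : Finite U := Module.finite_of_finite F
  have : Fintype U := Fintype.ofFinite U
  have hq : 2 ≤ Nat.card F := Finite.one_lt_card
  have card_tuples : {v : Fin k → V | LinearIndependent F v ∧ ∀ i, v i ∈ U}.ncard =
      ∏ i : Fin k, (Nat.card F ^ Module.finrank F U - Nat.card F ^ (i : ℕ)) := by
    rw [Nat.card_eq_fintype_card, ← card_linearIndependent hk, ← Nat.card_coe_set_eq]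
    exact Nat.card_congr
      { toFun v := ⟨fun i ↦ ⟨v.1 i, v.2.2 i⟩, .of_comp U.subtype v.2.1⟩
        invFun u := ⟨fun i ↦ u.1 i, u.2.map' U.subtype U.ker_subtype, fun i ↦ (u.1 i).2⟩ }
  have pow_le_factor (i : Fin k) : Nat.card F ^ Module.finrank F U ≤
      Nat.card F * (Nat.card F ^ Module.finrank F U - Nat.card F ^ (i : ℕ)) := by
    have pow_succ_le : Nat.card F * Nat.card F ^ (i : ℕ) ≤ Nat.card F ^ Module.finrank F U := by
      rw [← pow_succ']
      exact Nat.pow_le_pow_right (by lia) (by lia)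
    rw [Nat.mul_sub]
    have := Nat.mul_le_mul_right (Nat.card F ^ Module.finrank F U) hq
    lia
  calc Nat.card F ^ (Module.finrank F U * k)
      = ∏ _i : Fin k, Nat.card F ^ Module.finrank F U := by
        rw [Finset.prod_const, Finset.card_univ, Fintype.card_fin, pow_mul]
    _ ≤ ∏ i : Fin k, Nat.card F * (Nat.card F ^ Module.finrank F U - Nat.card F ^ (i : ℕ)) :=
        Finset.prod_le_prod' fun i _ ↦ pow_le_factor i
    _ = _ := by
        rw [Finset.prod_mul_distrib, Finset.prod_const, Finset.card_univ, Fintype.card_fin,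
          card_tuples]

theorem card_le_finrank_of_linearIndependent_mem {R M ι : Type*} [Ring R] [StrongRankCondition R]
    [AddCommGroup M] [Module R M] [Fintype ι] {v : ι → M} (hv : LinearIndependent R v)
    (U : Submodule R M) [Module.Finite R U] (hU : ∀ i, v i ∈ U) :
    Fintype.card ι ≤ Module.finrank R U :=
  (LinearIndependent.of_comp U.subtype (v := fun i ↦ (⟨v i, hU i⟩ : U)) hv).fintype_card_le_finrank

theorem ncard_mul_pow_le_of_finrank_inf_lt [FiniteDimensional F V] {r k : ℕ} (hk : k ≤ r)
    {C : Set (Submodule F V)} (hr : ∀ U ∈ C, Module.finrank F U = r)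
    (hC : C.Pairwise fun U W ↦ Module.finrank F (U ⊓ W : Submodule F V) < k) :
    C.ncard * Nat.card F ^ (r * k) ≤ Nat.card F ^ ((Module.finrank F V + 1) * k) := by
  classical
  have : Finite V := Module.finite_of_finite F
  have : Fintype V := Fintype.ofFinite V
  have : Fintype C := Fintype.ofFinite C
  let lies (U : Submodule F V) (v : Fin k → V) : Prop := LinearIndependent F v ∧ ∀ i, v i ∈ U
  have many_tuples : ∀ U ∈ C.toFinset, Nat.card F ^ (r * k) ≤
      Nat.card F ^ k * (Finset.univ.bipartiteAbove lies U).card := by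
    intro U hU
    have hUr := hr U (Set.mem_toFinset.1 hU)
    rw [← Set.ncard_coe_finset, Finset.coe_bipartiteAbove, ← hUr]
    simpa [lies] using pow_le_pow_mul_ncard_linearIndependent U (hk.trans_eq hUr.symm)
  have unique_subspace : ∀ v ∈ Finset.univ, (C.toFinset.bipartiteBelow lies v).card ≤ 1 := by
    refine fun v _ ↦ Finset.card_le_one.2 fun U hU W hW ↦ ?_
    simp only [Finset.mem_bipartiteBelow, Set.mem_toFinset] at hU hW
    by_contra hne
    have := card_le_finrank_of_linearIndependent_mem hU.2.1 (U ⊓ W) fun i ↦ ⟨hU.2.2 i, hW.2.2 i⟩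
    rw [Fintype.card_fin] at this
    exact (hC hU.1 hW.1 hne).not_ge this
  calc C.ncard * Nat.card F ^ (r * k)
      = ∑ _U ∈ C.toFinset, Nat.card F ^ (r * k) := by
        rw [Finset.sum_const, smul_eq_mul, Set.ncard_eq_toFinset_card']
    _ ≤ ∑ U ∈ C.toFinset, Nat.card F ^ k * (Finset.univ.bipartiteAbove lies U).card :=
        Finset.sum_le_sum many_tuples
    _ = Nat.card F ^ k * ∑ v, (C.toFinset.bipartiteBelow lies v).card := by
        rw [← Finset.mul_sum, Finset.sum_card_bipartiteAbove_eq_sum_card_bipartiteBelow]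
    _ ≤ Nat.card F ^ k * ∑ _v : Fin k → V, 1 := by
        gcongr
        exact unique_subspace _ (Finset.mem_univ _)
    _ = Nat.card F ^ ((Module.finrank F V + 1) * k) := by
        rw [Finset.sum_const, Finset.card_univ, smul_eq_mul, mul_one, ← Nat.card_eq_fintype_card,
          Nat.card_fun, Nat.card_fin, Module.natCard_eq_pow_finrank (K := F) (V := V), ← pow_mul,
          ← pow_add, add_one_mul, add_comm]

end Packing

section ConstantDimension

variable {F : Type*} [Field F] {n d r s : ℕ}

theorem injDist_eq_sub_of_finrank_eq {U V : ProjSpace F n} (hU : Module.finrank F U = r)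
    (hV : Module.finrank F V = r) :
    injDist U V = r - Module.finrank F (U ⊓ V : ProjSpace F n) := by
  rw [injDist, hU, hV, max_self]

theorem finrank_inf_lt_of_ne {V : Type*} [AddCommGroup V] [Module F V] [FiniteDimensional F V]
    {U W : Submodule F V} (h : Module.finrank F U = Module.finrank F W) (hne : U ≠ W) :
    Module.finrank F (U ⊓ W : Submodule F V) < Module.finrank F U := by
  refine Submodule.finrank_lt_finrank_of_lt (inf_lt_left.2 fun hle ↦ hne ?_)
  exact Submodule.eq_of_le_of_finrank_eq hle h

theorem IsCode.ncard_le_maxCDC [Finite F] {C : Set (ProjSpace F n)} (hC : IsCode d C)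
    (hr : ∀ U ∈ C, Module.finrank F U = r) : C.ncard ≤ maxCDC F n r d := by
  obtain ⟨U, hU⟩ := hC.1
  have hrn : r ≤ n := by simpa [hr U hU] using Submodule.finrank_le U
  exact (isGreatest_maxCDC F n r d hrn).2 ⟨C, hC, hr, rfl⟩

theorem maxCDC_le_pow_mul [Finite F] (h : r + s = n) :
    maxCDC F n r d ≤ Nat.card F ^ ((s + 1) * (r + 1 - d)) := by
  subst h
  obtain ⟨C, ⟨-, hC⟩, hr, hcard⟩ := (isGreatest_maxCDC F (r + s) r d (by lia)).1
  have hq : 0 < Nat.card F := Nat.card_pos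
  have hinf : C.Pairwise fun U W ↦
      Module.finrank F (U ⊓ W : ProjSpace F (r + s)) < min r (r + 1 - d) := by
    intro U hU W hW hne
    have hdist := hC U hU W hW hne
    have hlt := finrank_inf_lt_of_ne ((hr U hU).trans (hr W hW).symm) hne
    rw [injDist_eq_sub_of_finrank_eq (hr U hU) (hr W hW)] at hdist
    rw [hr U hU] at hlt
    lia
  have hpack := ncard_mul_pow_le_of_finrank_inf_lt (min_le_left _ _) hr hinf
  rw [hcard, Module.finrank_fin_fun, add_assoc, add_mul, pow_add, mul_comm] at hpack
  calc maxCDC F (r + s) r d ≤ Nat.card F ^ ((s + 1) * min r (r + 1 - d)) :=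
        Nat.le_of_mul_le_mul_left hpack (pow_pos hq _)
    _ ≤ Nat.card F ^ ((s + 1) * (r + 1 - d)) :=
        Nat.pow_le_pow_right hq (Nat.mul_le_mul_left _ (min_le_right _ _))

end ConstantDimension

section Duality

variable {F ι : Type*} [Field F] [Fintype ι] [DecidableEq ι] {n d r s : ℕ}

/-- The orthogonal complement of a subspace of `F ^ ι` with respect to the dot product. -/
def dotOrthogonal (U : Submodule F (ι → F)) : Submodule F (ι → F) :=
  U.dualAnnihilator.comap (dotProductEquiv F ι).toLinearMap

theorem dotOrthogonal_sup (U V : Submodule F (ι → F)) :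
    dotOrthogonal (U ⊔ V) = dotOrthogonal U ⊓ dotOrthogonal V := by
  rw [dotOrthogonal, Submodule.dualAnnihilator_sup_eq, Submodule.comap_inf, dotOrthogonal,
    dotOrthogonal]

theorem dotOrthogonal_injective :
    Function.Injective (dotOrthogonal : Submodule F (ι → F) → Submodule F (ι → F)) := fun _ _ h ↦
  Subspace.dualAnnihilator_inj.1
    (Submodule.comap_injective_of_surjective (dotProductEquiv F ι).surjective h)

theorem finrank_add_finrank_dotOrthogonal (U : Submodule F (ι → F)) :
    Module.finrank F U + Module.finrank F (dotOrthogonal U) = Fintype.card ι := by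
  rw [← Module.finrank_fintype_fun_eq_card F, ← Subspace.finrank_add_finrank_dualAnnihilator_eq U]
  congr 1
  exact ((dotProductEquiv F ι).ofSubmodule' _).finrank_eq

theorem injDist_dotOrthogonal (U V : ProjSpace F n) :
    injDist (dotOrthogonal U) (dotOrthogonal V) = injDist U V := by
  have hsum := Submodule.finrank_sup_add_finrank_inf_eq U V
  have hU := finrank_add_finrank_dotOrthogonal U
  have hV := finrank_add_finrank_dotOrthogonal V
  have hsup := finrank_add_finrank_dotOrthogonal (U ⊔ V)
  rw [dotOrthogonal_sup] at hsup
  unfold injDist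
  lia

theorem IsCode.image_dotOrthogonal {C : Set (ProjSpace F n)} (hC : IsCode d C) :
    IsCode d (dotOrthogonal '' C) := by
  refine ⟨hC.1.image _, ?_⟩
  rintro _ ⟨U, hU, rfl⟩ _ ⟨V, hV, rfl⟩ hne
  rw [injDist_dotOrthogonal]
  exact hC.2 U hU V hV (ne_of_apply_ne _ hne)

theorem maxCDC_le_maxCDC_of_add_eq [Finite F] (h : r + s = n) :
    maxCDC F n r d ≤ maxCDC F n s d := by
  obtain ⟨C, hC, hr, hcard⟩ := (isGreatest_maxCDC F n r d (by lia)).1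
  rw [← hcard, ← Set.ncard_image_of_injective C dotOrthogonal_injective]
  refine hC.image_dotOrthogonal.ncard_le_maxCDC ?_
  rintro _ ⟨U, hU, rfl⟩
  have hUn := finrank_add_finrank_dotOrthogonal U
  rw [hr U hU, Fintype.card_fin] at hUn
  lia

theorem maxCDC_eq_maxCDC_of_add_eq [Finite F] (h : r + s = n) :
    maxCDC F n r d = maxCDC F n s d :=
  (maxCDC_le_maxCDC_of_add_eq h).antisymm (maxCDC_le_maxCDC_of_add_eq (by rwa [add_comm]))

end Duality

section RankMetricCodes

/-- The polynomial `∑ i, a i * X ^ (q ^ i)`, which is called linearized when `q` is the order of a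
subfield of `R`. -/
noncomputable def linearizedPoly {R : Type*} [Semiring R] (q : ℕ) {k : ℕ} (a : Fin k → R) :
    Polynomial R :=
  ∑ i : Fin k, Polynomial.monomial (q ^ (i : ℕ)) (a i)

theorem linearizedPoly_ne_zero {R : Type*} [Semiring R] {q k : ℕ} (hq : 1 < q) {a : Fin k → R}
    (ha : a ≠ 0) : linearizedPoly q a ≠ 0 := by
  obtain ⟨i, hi⟩ := Function.ne_iff.1 ha
  have coeff_eq : (linearizedPoly q a).coeff (q ^ (i : ℕ)) = a i := by
    simp [linearizedPoly, Polynomial.finsetSum_coeff, Polynomial.coeff_monomial,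
      Nat.pow_right_inj hq, Fin.val_inj]
  intro h
  rw [h, Polynomial.coeff_zero] at coeff_eq
  exact hi coeff_eq.symm

theorem degree_linearizedPoly_lt {R : Type*} [Semiring R] {q k : ℕ} (hq : 1 < q) (a : Fin k → R) :
    (linearizedPoly q a).degree < (q ^ k : ℕ) := by
  refine Polynomial.mem_degreeLT.1 (Submodule.sum_mem _ fun i _ ↦ Polynomial.mem_degreeLT.2 ?_)
  refine (Polynomial.degree_monomial_le _ _).trans_lt ?_
  exact_mod_cast Nat.pow_lt_pow_right hq i.2

/-- The `F`-linear map `x ↦ ∑ i, a i * x ^ (q ^ i)` on `L`, where `q` is the order of `F`, as an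
`L`-linear function of the coefficient vector `a`. -/
noncomputable def linearizedMap (F L : Type*) [Field F] [Fintype F] [CommRing L] [Algebra F L]
    (k : ℕ) : (Fin k → L) →ₗ[L] L →ₗ[F] L :=
  Fintype.linearCombination L fun i : Fin k ↦
    (FiniteField.frobeniusAlgHom F L ^ (i : ℕ)).toLinearMap

variable {F : Type*} [Field F]

theorem linearizedMap_apply {L : Type*} [Fintype F] [CommRing L] [Algebra F L] {k : ℕ}
    (a : Fin k → L) (x : L) :
    linearizedMap F L k a x = (linearizedPoly (Nat.card F) a).eval x := by
  simp [linearizedMap, linearizedPoly, Fintype.linearCombination_apply, Polynomial.eval_finsetSum,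
    FiniteField.coe_frobeniusAlgHom, AlgHom.coe_pow, pow_iterate]

theorem finrank_ker_linearizedMap_lt {L : Type*} [Fintype F] [CommRing L] [IsDomain L]
    [Algebra F L] {k : ℕ} {a : Fin k → L} (ha : a ≠ 0) :
    Module.finrank F (LinearMap.ker (linearizedMap F L k a)) < k := by
  classical
  have hq : 1 < Nat.card F := Finite.one_lt_card
  set P := linearizedPoly (Nat.card F) a
  have hP : P ≠ 0 := linearizedPoly_ne_zero hq ha
  have ker_eq_roots : (LinearMap.ker (linearizedMap F L k a) : Set L) = P.roots.toFinset := by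
    ext x
    rw [SetLike.mem_coe, LinearMap.mem_ker, linearizedMap_apply, Finset.mem_coe,
      Multiset.mem_toFinset, Polynomial.mem_roots hP, Polynomial.IsRoot.def]
  have : Finite (LinearMap.ker (linearizedMap F L k a)) :=
    Set.Finite.to_subtype (ker_eq_roots ▸ P.roots.toFinset.finite_toSet)
  have card_ker_lt : Nat.card (LinearMap.ker (linearizedMap F L k a)) < Nat.card F ^ k := by
    calc Nat.card (LinearMap.ker (linearizedMap F L k a)) = P.roots.toFinset.card := by
          rw [← SetLike.coe_sort_coe, Nat.card_coe_set_eq, ker_eq_roots, Set.ncard_coe_finset]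
      _ ≤ P.roots.card := Multiset.toFinset_card_le _
      _ < Nat.card F ^ k := by
          exact_mod_cast (Polynomial.card_roots hP).trans_lt (degree_linearizedPoly_lt hq a)
  rwa [Module.natCard_eq_pow_finrank (K := F), Nat.pow_lt_pow_iff_right hq] at card_ker_lt

theorem finrank_ker_comp_le_of_injective {V V' W : Type*} [AddCommGroup V] [Module F V]
    [AddCommGroup V'] [Module F V'] [FiniteDimensional F V'] [AddCommGroup W] [Module F W]
    {j : V →ₗ[F] V'} (hj : Function.Injective j) (f : V' →ₗ[F] W) :
    Module.finrank F (LinearMap.ker (f ∘ₗ j)) ≤ Module.finrank F (LinearMap.ker f) := by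
  rw [LinearMap.ker_comp, (Submodule.equivMapOfInjective j hj _).finrank_eq]
  exact Submodule.finrank_mono (Submodule.map_comap_le _ _)

theorem exists_field_extension_finrank_eq (F : Type*) [Field F] [Finite F] {m : ℕ} (hm : m ≠ 0) :
    ∃ (L : Type) (_ : Field L) (_ : Algebra F L), Module.finrank F L = m := by
  obtain ⟨p, _⟩ := CharP.exists F
  have : Fact p.Prime := ⟨CharP.char_is_prime F p⟩
  have : NeZero m := ⟨hm⟩
  exact ⟨FiniteField.Extension F p m, inferInstance, inferInstance,
    FiniteField.finrank_extension F p m⟩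

theorem exists_rankMetricCode [Finite F] {V W : Type*} [AddCommGroup V] [Module F V]
    [FiniteDimensional F V] [AddCommGroup W] [Module F W] [FiniteDimensional F W]
    (hVW : Module.finrank F V ≤ Module.finrank F W) {k : ℕ} (hk : k ≤ Module.finrank F V) :
    ∃ S : Submodule F (V →ₗ[F] W), Module.finrank F S = Module.finrank F W * k ∧
      ∀ f ∈ S, f ≠ 0 → Module.finrank F (LinearMap.ker f) < k := by
  have : Fintype F := Fintype.ofFinite F
  obtain rfl | hk0 := Nat.eq_zero_or_pos k
  · exact ⟨⊥, by simp, fun f hf hf0 ↦ absurd hf hf0⟩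
  obtain ⟨L, _, _, hL⟩ := exists_field_extension_finrank_eq F (m := Module.finrank F W) (by lia)
  have : FiniteDimensional F L := Module.finite_of_finrank_pos (by lia)
  let e : L ≃ₗ[F] W := LinearEquiv.ofFinrankEq _ _ hL
  obtain ⟨j, hj⟩ : ∃ j : V →ₗ[F] L, Function.Injective j :=
    finrank_le_iff_exists_linearMap.1 (hVW.trans_eq hL.symm)
  let Φ : (Fin k → L) →ₗ[F] V →ₗ[F] W :=
    LinearMap.lcomp F W j ∘ₗ LinearMap.compRight F e.toLinearMap ∘ₗ
      (linearizedMap F L k).restrictScalars F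
  have Φ_apply (a : Fin k → L) : Φ a = (e.toLinearMap ∘ₗ linearizedMap F L k a) ∘ₗ j := rfl
  have finrank_ker_lt (a : Fin k → L) (ha : a ≠ 0) :
      Module.finrank F (LinearMap.ker (Φ a)) < k := by
    rw [Φ_apply]
    calc Module.finrank F (LinearMap.ker ((e.toLinearMap ∘ₗ linearizedMap F L k a) ∘ₗ j))
        ≤ Module.finrank F (LinearMap.ker (e.toLinearMap ∘ₗ linearizedMap F L k a)) :=
          finrank_ker_comp_le_of_injective hj _
      _ = Module.finrank F (LinearMap.ker (linearizedMap F L k a)) := by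
          rw [LinearEquiv.ker_comp]
      _ < k := finrank_ker_linearizedMap_lt ha
  have hΦ : Function.Injective Φ := by
    refine (injective_iff_map_eq_zero Φ).2 fun a ha ↦ ?_
    by_contra hne
    have := finrank_ker_lt a hne
    rw [ha, LinearMap.ker_zero, finrank_top] at this
    lia
  refine ⟨LinearMap.range Φ, ?_, ?_⟩
  · rw [LinearMap.finrank_range_of_inj hΦ, Module.finrank_pi_fintype, Finset.sum_const,
      Finset.card_univ, Fintype.card_fin, hL, smul_eq_mul, mul_comm]
  · rintro _ ⟨a, rfl⟩ hne
    exact finrank_ker_lt a fun ha ↦ hne (by rw [ha, map_zero])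

end RankMetricCodes

section Lifting

theorem graph_inf_graph {R V W : Type*} [Ring R] [AddCommGroup V] [Module R V] [AddCommGroup W]
    [Module R W] (f g : V →ₗ[R] W) :
    f.graph ⊓ g.graph = (LinearMap.ker (f - g)).map (LinearMap.id.prod f) := by
  ext ⟨x, y⟩
  simp only [Submodule.mem_inf, LinearMap.mem_graph_iff, Submodule.mem_map, LinearMap.mem_ker,
    LinearMap.sub_apply, sub_eq_zero, LinearMap.prod_apply, Function.prod, LinearMap.id_apply,
    Prod.mk.injEq]
  constructor
  · rintro ⟨hf, hg⟩
    exact ⟨x, hf.symm.trans hg, rfl, hf.symm⟩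
  · rintro ⟨_, h, rfl, rfl⟩
    exact ⟨rfl, h⟩

theorem finrank_graph_inf_graph {R V W : Type*} [Ring R] [AddCommGroup V] [Module R V]
    [AddCommGroup W] [Module R W] (f g : V →ₗ[R] W) :
    Module.finrank R (f.graph ⊓ g.graph : Submodule R (V × W)) =
      Module.finrank R (LinearMap.ker (f - g)) := by
  have prod_injective : Function.Injective (LinearMap.id.prod f) :=
    fun _ _ h ↦ congrArg Prod.fst h
  rw [graph_inf_graph, ← (Submodule.equivMapOfInjective _ prod_injective _).finrank_eq]

theorem graph_injective {R V W : Type*} [Semiring R] [AddCommMonoid V] [Module R V]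
    [AddCommMonoid W] [Module R W] :
    Function.Injective (LinearMap.graph : (V →ₗ[R] W) → Submodule R (V × W)) := fun f g h ↦
  LinearMap.ext fun x ↦ (g.mem_graph_iff (x := (x, f x))).1
    (h ▸ (f.mem_graph_iff (x := (x, f x))).2 rfl)

variable {F : Type*} [Field F] [Finite F] {n d r s : ℕ}

theorem ncard_le_maxCDC_of_finrank_ker_sub_lt {V W : Type*} [AddCommGroup V] [Module F V]
    [FiniteDimensional F V] [AddCommGroup W] [Module F W] [FiniteDimensional F W]
    (hn : Module.finrank F V + Module.finrank F W = n) {S : Set (V →ₗ[F] W)} (hne : S.Nonempty)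
    (hS : S.Pairwise fun f g ↦ Module.finrank F (LinearMap.ker (f - g)) + d ≤ Module.finrank F V) :
    S.ncard ≤ maxCDC F n (Module.finrank F V) d := by
  let e : (V × W) ≃ₗ[F] (Fin n → F) :=
    LinearEquiv.ofFinrankEq _ _ (by rw [Module.finrank_prod, Module.finrank_fin_fun, hn])
  let lift (f : V →ₗ[F] W) : ProjSpace F n := f.graph.map e.toLinearMap
  have lift_injective : Function.Injective lift :=
    (Submodule.map_injective_of_injective e.injective).comp graph_injective
  have finrank_lift_inf (f g : V →ₗ[F] W) : Module.finrank F (lift f ⊓ lift g : ProjSpace F n) =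
      Module.finrank F (LinearMap.ker (f - g)) := by
    rw [← finrank_graph_inf_graph, ← LinearEquiv.finrank_map_eq e,
      ← Submodule.map_inf _ e.injective]
  have finrank_lift (f : V →ₗ[F] W) : Module.finrank F (lift f) = Module.finrank F V := by
    have := finrank_lift_inf f f
    rwa [inf_idem, sub_self, LinearMap.ker_zero, finrank_top] at this
  have lift_isCode : IsCode d (lift '' S) := by
    refine ⟨hne.image _, ?_⟩
    rintro _ ⟨f, hf, rfl⟩ _ ⟨g, hg, rfl⟩ hfg
    rw [injDist_eq_sub_of_finrank_eq (finrank_lift f) (finrank_lift g), finrank_lift_inf]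
    have := hS hf hg (ne_of_apply_ne _ hfg)
    lia
  rw [← Set.ncard_image_of_injective S lift_injective]
  refine lift_isCode.ncard_le_maxCDC ?_
  rintro _ ⟨f, -, rfl⟩
  exact finrank_lift f

theorem pow_mul_le_maxCDC (h : r + s = n) (hrs : r ≤ s) :
    Nat.card F ^ (s * (r - d)) ≤ maxCDC F n r d := by
  obtain ⟨S, hcard, hS⟩ := exists_rankMetricCode (F := F) (V := Fin r → F) (W := Fin s → F)
    (k := r - d) (by simpa using hrs) (by simp)
  have hcode := ncard_le_maxCDC_of_finrank_ker_sub_lt (n := n) (d := d) (by simpa using h)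
    S.nonempty fun f hf g hg hne ↦ by
      have := hS (f - g) (S.sub_mem hf hg) (sub_ne_zero.2 hne)
      rw [Module.finrank_fin_fun]
      lia
  rwa [← Nat.card_coe_set_eq, SetLike.coe_sort_coe, Module.natCard_eq_pow_finrank (K := F), hcard,
    Module.finrank_fin_fun, Module.finrank_fin_fun] at hcode

end Lifting

section CodeSize

variable {F : Type*} [Field F] [Finite F] {n d r s : ℕ}

theorem pow_le_maxCDC (h : r + s = n) :
    Nat.card F ^ (max r s * (min r s - d)) ≤ maxCDC F n r d := by
  wlog hrs : r ≤ s generalizing r s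
  · rw [maxCDC_eq_maxCDC_of_add_eq h, max_comm, min_comm]
    exact this (by rwa [add_comm]) (by lia)
  rw [max_eq_right hrs, min_eq_left hrs]
  exact pow_mul_le_maxCDC h hrs

theorem maxCDC_le_pow (h : r + s = n) :
    maxCDC F n r d ≤ Nat.card F ^ (max r s * (min r s - d) + (n + 1)) := by
  wlog hrs : r ≤ s generalizing r s
  · rw [maxCDC_eq_maxCDC_of_add_eq h, max_comm, min_comm]
    exact this (by rwa [add_comm]) (by lia)
  have exponent_le : (s + 1) * (r + 1 - d) ≤ s * (r - d) + (n + 1) :=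
    calc (s + 1) * (r + 1 - d) ≤ (s + 1) * (r - d + 1) := Nat.mul_le_mul_left _ (by lia)
      _ = s * (r - d) + (r - d + s + 1) := by ring
      _ ≤ s * (r - d) + (n + 1) := by lia
  rw [max_eq_right hrs, min_eq_left hrs]
  exact (maxCDC_le_pow_mul h).trans (Nat.pow_le_pow_right Nat.card_pos exponent_le)

theorem maxCDC_le_maxCode (hr : r ≤ n) : maxCDC F n r d ≤ maxCode F n d := by
  obtain ⟨C, hC, -, hcard⟩ := (isGreatest_maxCDC F n r d hr).1
  exact (isGreatest_maxCode F n d).2 ⟨C, hC, hcard⟩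

theorem IsCode.ncard_finrank_eq_le_maxCDC {C : Set (ProjSpace F n)} (hC : IsCode d C) (r : ℕ) :
    {U ∈ C | Module.finrank F U = r}.ncard ≤ maxCDC F n r d := by
  obtain hempty | hne := {U ∈ C | Module.finrank F U = r}.eq_empty_or_nonempty
  · simp [hempty]
  · have hcode : IsCode d {U ∈ C | Module.finrank F U = r} :=
      ⟨hne, fun U hU V hV ↦ hC.2 U hU.1 V hV.1⟩
    exact hcode.ncard_le_maxCDC fun U hU ↦ hU.2

variable (F n d) in
theorem exists_maxCode_le_mul_maxCDC :
    ∃ r ≤ n, maxCode F n d ≤ maxCDC F n r d * (n + 1) := by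
  classical
  obtain ⟨r, hrn, hr⟩ :=
    Finset.exists_max_image (Finset.range (n + 1)) (maxCDC F n · d) Finset.nonempty_range_add_one
  refine ⟨r, Finset.mem_range_succ_iff.1 hrn, ?_⟩
  obtain ⟨C, hC, hcard⟩ := (isGreatest_maxCode F n d).1
  have : Fintype C := Fintype.ofFinite C
  have finrank_mem : ∀ U ∈ C.toFinset, Module.finrank F U ∈ Finset.range (n + 1) := fun U _ ↦
    Finset.mem_range_succ_iff.2 (by simpa using Submodule.finrank_le U)
  have fiber_card_le : ∀ t ∈ Finset.range (n + 1),
      (C.toFinset.filter fun U : ProjSpace F n ↦ Module.finrank F U = t).card ≤ maxCDC F n r d := by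
    intro t ht
    refine le_trans ?_ (hr t ht)
    simpa [← Set.ncard_coe_finset] using hC.ncard_finrank_eq_le_maxCDC t
  have hle := Finset.card_le_mul_card_image_of_maps_to finrank_mem _ fiber_card_le
  rwa [Finset.card_range, ← Set.ncard_eq_toFinset_card', hcard] at hle

theorem maxCode_zero : maxCode F n 0 = Nat.card (ProjSpace F n) := by
  refine le_antisymm ?_ ?_
  · obtain ⟨C, -, hcard⟩ := (isGreatest_maxCode F n 0).1
    exact hcard ▸ Set.ncard_le_card C
  · exact (isGreatest_maxCode F n 0).2
      ⟨Set.univ, ⟨Set.univ_nonempty, fun _ _ _ _ _ ↦ Nat.zero_le _⟩, Set.ncard_univ _⟩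

end CodeSize

section RateFunction

variable {x δ : ℝ}

/-- The asymptotic rate `a_I(x, δ)` of constant-dimension codes of relative dimension `x` and
relative minimum injection distance `δ`, in a closed form that covers all ranges of `x`. -/
noncomputable def cdcRate (x δ : ℝ) : ℝ := 4 * max x (1 - x) * max 0 (min x (1 - x) - δ)

theorem cdcRate_eq_zero (h : x ≤ δ ∨ 1 - δ ≤ x) : cdcRate x δ = 0 := by
  rw [cdcRate, max_eq_left (b := min x (1 - x) - δ), mul_zero]
  rw [sub_nonpos, min_le_iff]
  exact h.imp_right sub_le_comm.1

theorem cdcRate_of_le_half (hδ : δ ≤ x) (hx : x ≤ 1 / 2) :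
    cdcRate x δ = 4 * (1 - x) * (x - δ) := by
  rw [cdcRate, max_eq_right (by linarith), min_eq_left (by linarith), max_eq_right (by linarith)]

theorem cdcRate_of_half_le (hx : 1 / 2 ≤ x) (hδ : x ≤ 1 - δ) :
    cdcRate x δ = 4 * x * (1 - x - δ) := by
  rw [cdcRate, max_eq_left (by linarith), min_eq_right (by linarith), max_eq_right (by linarith)]

theorem cdcRate_le_cdcRate_half (hδ : 0 ≤ δ) : cdcRate x δ ≤ cdcRate (1 / 2) δ := by
  obtain hzero | ⟨hδx, hxδ⟩ : (x ≤ δ ∨ 1 - δ ≤ x) ∨ δ < x ∧ x < 1 - δ := by grind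
  · rw [cdcRate_eq_zero hzero, cdcRate]
    norm_num
  · rw [cdcRate_of_le_half (by linarith) le_rfl]
    obtain hx | hx := le_total x (1 / 2)
    · rw [cdcRate_of_le_half hδx.le hx]
      nlinarith
    · rw [cdcRate_of_half_le hx hxδ.le]
      nlinarith

theorem continuous_cdcRate : Continuous fun p : ℝ × ℝ ↦ cdcRate p.1 p.2 := by
  unfold cdcRate
  fun_prop

theorem natCast_max_mul_min_sub {n d r s : ℕ} (h : r + s = n) (hn : 0 < n) :
    ((max r s * (min r s - d) : ℕ) : ℝ) = cdcRate (r / n) (d / n) * (n ^ 2 / 4) := by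
  have hn0 : (0 : ℝ) < n := Nat.cast_pos.2 hn
  have hs : 1 - (r : ℝ) / n = s / n := by
    rw [← h, Nat.cast_add] at hn0 ⊢
    field_simp
    ring
  have hsub : ((min r s - d : ℕ) : ℝ) = max 0 (((min r s : ℕ) : ℝ) - d) := by
    rw [Nat.sub_eq_max_sub, Nat.cast_sub (le_max_right _ _), Nat.cast_max,
      ← max_sub_sub_right, sub_self, max_comm]
  rw [cdcRate, hs, max_div_div_right hn0.le, min_div_div_right hn0.le, ← sub_div,
    ← zero_div (n : ℝ), max_div_div_right hn0.le, Nat.cast_mul, hsub, Nat.cast_max, Nat.cast_min]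
  field_simp

end RateFunction

section LogSize

variable {F : Type*} [Field F] [Finite F] {n d r s : ℕ}

theorem natCast_le_logb_of_pow_le {q k m : ℕ} (hq : 1 < q) (h : q ^ k ≤ m) :
    (k : ℝ) ≤ Real.logb q m := by
  rw [Real.le_logb_iff_rpow_le (by exact_mod_cast hq)
    (by exact_mod_cast (pow_pos (by lia) k).trans_le h), Real.rpow_natCast]
  exact_mod_cast h

theorem logb_le_natCast_of_le_pow {q k m : ℕ} (hq : 1 < q) (h : m ≤ q ^ k) :
    Real.logb q m ≤ k := by
  obtain rfl | hm := m.eq_zero_or_pos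
  · simp
  rw [Real.logb_le_iff_le_rpow (by exact_mod_cast hq) (by exact_mod_cast hm), Real.rpow_natCast]
  exact_mod_cast h

theorem cdcRate_mul_le_logb_maxCDC (hn : 0 < n) (hr : r ≤ n) :
    cdcRate (r / n) (d / n) * (n ^ 2 / 4) ≤ Real.logb (Nat.card F) (maxCDC F n r d) := by
  have h : r + (n - r) = n := Nat.add_sub_of_le hr
  rw [← natCast_max_mul_min_sub h hn]
  exact natCast_le_logb_of_pow_le Finite.one_lt_card (pow_le_maxCDC h)

theorem logb_maxCDC_le (hn : 0 < n) (hr : r ≤ n) :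
    Real.logb (Nat.card F) (maxCDC F n r d) ≤
      cdcRate (r / n) (d / n) * (n ^ 2 / 4) + (n + 1) := by
  have h : r + (n - r) = n := Nat.add_sub_of_le hr
  rw [← natCast_max_mul_min_sub h hn]
  exact_mod_cast logb_le_natCast_of_le_pow Finite.one_lt_card (maxCDC_le_pow h)

theorem cdcRate_mul_le_logb_maxCode (hn : 0 < n) (hr : r ≤ n) :
    cdcRate (r / n) (d / n) * (n ^ 2 / 4) ≤ Real.logb (Nat.card F) (maxCode F n d) := by
  have h : r + (n - r) = n := Nat.add_sub_of_le hr
  rw [← natCast_max_mul_min_sub h hn]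
  exact natCast_le_logb_of_pow_le Finite.one_lt_card
    ((pow_le_maxCDC h).trans (maxCDC_le_maxCode hr))

theorem logb_maxCode_le (hn : 0 < n) :
    Real.logb (Nat.card F) (maxCode F n d) ≤
      cdcRate (1 / 2) (d / n) * (n ^ 2 / 4) + (2 * n + 1) := by
  obtain ⟨r, hr, hmax⟩ := exists_maxCode_le_mul_maxCDC F n d
  have h : r + (n - r) = n := Nat.add_sub_of_le hr
  have maxCode_le_pow : maxCode F n d ≤
      Nat.card F ^ (max r (n - r) * (min r (n - r) - d) + (2 * n + 1)) :=
    calc maxCode F n d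
        ≤ Nat.card F ^ (max r (n - r) * (min r (n - r) - d) + (n + 1)) * Nat.card F ^ n :=
          hmax.trans (Nat.mul_le_mul (maxCDC_le_pow h) (Nat.lt_pow_self Finite.one_lt_card))
      _ = _ := by rw [← pow_add]; congr 1; ring
  calc Real.logb (Nat.card F) (maxCode F n d)
      ≤ cdcRate (r / n) (d / n) * (n ^ 2 / 4) + (2 * n + 1) := by
        rw [← natCast_max_mul_min_sub h hn]
        exact_mod_cast logb_le_natCast_of_le_pow Finite.one_lt_card maxCode_le_pow
    _ ≤ cdcRate (1 / 2) (d / n) * (n ^ 2 / 4) + (2 * n + 1) := by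
        gcongr
        exact cdcRate_le_cdcRate_half (by positivity)

end LogSize

section Asymptotics

variable {F : Type*} [Field F] [Finite F] {l : Filter ℕ} {r d : ℕ → ℕ} {r' d' : ℝ}

theorem tendsto_div_sq_of_le_of_le {u v L : ℕ → ℝ} {a : ℝ} (hl : l ≤ atTop)
    (hu : Tendsto u l (𝓝 a)) (hv : Tendsto v l (𝓝 a))
    (hlower : ∀ᶠ n : ℕ in l, u n * (n ^ 2 / 4) ≤ L n)
    (hupper : ∀ᶠ n : ℕ in l, L n ≤ v n * (n ^ 2 / 4) + (2 * n + 1)) :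
    Tendsto (fun n : ℕ ↦ L n / ((n : ℝ) ^ 2 / 4)) l (𝓝 a) := by
  have hinv : Tendsto (fun n : ℕ ↦ 1 / (n : ℝ)) l (𝓝 0) :=
    tendsto_one_div_atTop_nhds_zero_nat.mono_left hl
  have hv' : Tendsto (fun n : ℕ ↦ v n + (8 * (1 / (n : ℝ)) + 4 * (1 / (n : ℝ)) ^ 2)) l (𝓝 a) := by
    simpa using hv.add ((hinv.const_mul 8).add ((hinv.pow 2).const_mul 4))
  refine tendsto_of_tendsto_of_tendsto_of_le_of_le' hu hv' ?_ ?_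
  · filter_upwards [hlower, hl (eventually_gt_atTop 0)] with n h hn
    exact (le_div_iff₀ (by positivity)).2 h
  · filter_upwards [hupper, hl (eventually_gt_atTop 0)] with n h hn
    rw [div_le_iff₀ (by positivity)]
    refine h.trans_eq ?_
    field_simp
    ring

theorem tendsto_cdcRate {x δ : ℕ → ℝ} {x' δ' : ℝ} (hx : Tendsto x l (𝓝 x'))
    (hδ : Tendsto δ l (𝓝 δ')) : Tendsto (fun n ↦ cdcRate (x n) (δ n)) l (𝓝 (cdcRate x' δ')) :=
  (continuous_cdcRate.tendsto (x', δ')).comp (hx.prodMk_nhds hδ)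

theorem tendsto_logb_maxCDC (hl : l ≤ atTop) (hrn : ∀ᶠ n in l, r n ≤ n)
    (hr : Tendsto (fun n ↦ (r n : ℝ) / n) l (𝓝 r'))
    (hd : Tendsto (fun n ↦ (d n : ℝ) / n) l (𝓝 d')) :
    Tendsto (fun n : ℕ ↦ Real.logb (Nat.card F) (maxCDC F n (r n) (d n)) / ((n : ℝ) ^ 2 / 4)) l
      (𝓝 (cdcRate r' d')) := by
  refine tendsto_div_sq_of_le_of_le hl (tendsto_cdcRate hr hd) (tendsto_cdcRate hr hd) ?_ ?_
  · filter_upwards [hrn, hl (eventually_gt_atTop 0)] with n hn hpos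
    exact cdcRate_mul_le_logb_maxCDC hpos hn
  · filter_upwards [hrn, hl (eventually_gt_atTop 0)] with n hn hpos
    linarith [logb_maxCDC_le (F := F) (d := d n) hpos hn, n.cast_nonneg (α := ℝ)]

theorem tendsto_natCast_half_div :
    Tendsto (fun n : ℕ ↦ ((n / 2 : ℕ) : ℝ) / n) atTop (𝓝 (1 / 2)) := by
  have h := (tendsto_nat_floor_mul_div_atTop (R := ℝ) (a := 1 / 2) (by norm_num)).comp
    tendsto_natCast_atTop_atTop
  refine h.congr fun n ↦ ?_
  rw [Function.comp_apply, one_div_mul_eq_div]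
  congr 2
  exact_mod_cast Nat.floor_div_eq_div (K := ℝ) n 2

theorem tendsto_natCeil_mul_div (hd : 0 ≤ d') :
    Tendsto (fun n : ℕ ↦ (⌈(n : ℝ) * d'⌉₊ : ℝ) / n) atTop (𝓝 d') := by
  refine ((tendsto_nat_ceil_mul_div_atTop hd).comp tendsto_natCast_atTop_atTop).congr fun n ↦ ?_
  rw [Function.comp_apply, mul_comm]

theorem tendsto_logb_maxCode (hl : l ≤ atTop) (hd : Tendsto (fun n ↦ (d n : ℝ) / n) l (𝓝 d')) :
    Tendsto (fun n : ℕ ↦ Real.logb (Nat.card F) (maxCode F n (d n)) / ((n : ℝ) ^ 2 / 4)) l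
      (𝓝 (cdcRate (1 / 2) d')) := by
  refine tendsto_div_sq_of_le_of_le hl
    (tendsto_cdcRate (tendsto_natCast_half_div.mono_left hl) hd)
    (tendsto_cdcRate tendsto_const_nhds hd) ?_ ?_
  · filter_upwards [hl (eventually_gt_atTop 0)] with n hpos
    exact cdcRate_mul_le_logb_maxCode hpos (n.div_le_self 2)
  · filter_upwards [hl (eventually_gt_atTop 0)] with n hpos
    exact logb_maxCode_le hpos

variable (F) in
theorem tendsto_logb_card_projSpace :
    Tendsto (fun n : ℕ ↦ Real.logb (Nat.card F) (Nat.card (ProjSpace F n)) / ((n : ℝ) ^ 2 / 4))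
      atTop (𝓝 1) := by
  have hrate : cdcRate (1 / 2) 0 = 1 := by
    rw [cdcRate_of_le_half (by norm_num) le_rfl]
    norm_num
  have h := tendsto_logb_maxCode (F := F) (d := fun _ ↦ 0) (d' := 0) le_rfl (by simp)
  simpa only [maxCode_zero, hrate] using h

theorem tendsto_rate {A : ℕ → ℕ} {a : ℝ} (hl : l ≤ atTop)
    (hA : Tendsto (fun n : ℕ ↦ Real.logb (Nat.card F) (A n) / ((n : ℝ) ^ 2 / 4)) l (𝓝 a)) :
    Tendsto (fun n ↦ rate F n (A n)) l (𝓝 a) := by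
  have hdiv := hA.div ((tendsto_logb_card_projSpace F).mono_left hl) one_ne_zero
  rw [div_one] at hdiv
  refine hdiv.congr' ?_
  filter_upwards [hl (eventually_gt_atTop 0)] with n hn
  exact div_div_div_cancel_right₀ (by positivity) _ _

theorem asympRate_eq (hd : 0 ≤ d') : asympRate F d' = (cdcRate (1 / 2) d' : EReal) :=
  ((continuous_coe_real_ereal.tendsto _).comp
    (tendsto_rate le_rfl (tendsto_logb_maxCode le_rfl (tendsto_natCeil_mul_div hd)))).limsup_eq

theorem asympRateCDC_eq {N : Set ℕ} (hN : N.Infinite) (hrn : ∀ n ∈ N, r n ≤ n)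
    (hr : Tendsto (fun n ↦ (r n : ℝ) / n) (atTop ⊓ 𝓟 N) (𝓝 r')) (hd : 0 ≤ d') :
    asympRateCDC F N r d' = (cdcRate r' d' : EReal) := by
  have : (atTop ⊓ 𝓟 N).NeBot :=
    frequently_mem_iff_neBot.1 (Nat.frequently_atTop_iff_infinite.2 hN)
  have hrn' : ∀ᶠ n in atTop ⊓ 𝓟 N, r n ≤ n :=
    (eventually_principal.2 hrn).filter_mono inf_le_right
  have hd' := (tendsto_natCeil_mul_div hd).mono_left (inf_le_left : atTop ⊓ 𝓟 N ≤ atTop)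
  exact ((continuous_coe_real_ereal.tendsto _).comp
    (tendsto_rate inf_le_left (tendsto_logb_maxCDC inf_le_left hrn' hr hd'))).limsup_eq

end Asymptotics

end SubspaceCode

/-- In the second part, `r n` is the dimension `n r'`, up to any rounding that is negligible with
respect to `n`. The choice `N = univ`, `r n = ⌊n r'⌋` takes all lengths; the choice
`N = {n | n r' is an integer}`, `r n = n r'` takes only those at which no rounding is needed. -/
theorem mainTheorem4 (F : Type*) [Field F] [Finite F] :
    (∀ d' : ℝ, 0 ≤ d' → d' ≤ 1 →
      (d' ≤ 1 / 2 → SubspaceCode.asympRate F d' = ((1 - 2 * d' : ℝ) : EReal)) ∧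
      (1 / 2 ≤ d' → SubspaceCode.asympRate F d' = 0)) ∧
    (∀ r' d' : ℝ, 0 ≤ r' → r' ≤ 1 → 0 ≤ d' → d' ≤ 1 →
      ∀ (N : Set ℕ) (r : ℕ → ℕ), N.Infinite → (∀ n ∈ N, r n ≤ n) →
      Tendsto (fun n : ℕ => (r n : ℝ) / (n : ℝ)) (atTop ⊓ 𝓟 N) (𝓝 r') →
      ((r' ≤ d' ∨ 1 - d' ≤ r') → SubspaceCode.asympRateCDC F N r d' = 0) ∧
      (d' ≤ r' → r' ≤ 1 / 2 →
        SubspaceCode.asympRateCDC F N r d' = ((4 * (1 - r') * (r' - d') : ℝ) : EReal)) ∧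
      (1 / 2 ≤ r' → r' ≤ 1 - d' →
        SubspaceCode.asympRateCDC F N r d' = ((4 * r' * (1 - r' - d') : ℝ) : EReal))) := by
  refine ⟨fun d' hd _ ↦ ?_, fun r' d' _ _ hd _ N r hN hrn hr ↦ ?_⟩
  · rw [SubspaceCode.asympRate_eq hd]
    refine ⟨fun h ↦ ?_, fun h ↦ ?_⟩
    · rw [SubspaceCode.cdcRate_of_le_half h le_rfl]
      congr 1
      ring
    · rw [SubspaceCode.cdcRate_eq_zero (.inl h), EReal.coe_zero]
  · rw [SubspaceCode.asympRateCDC_eq hN hrn hr hd]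
    refine ⟨fun h ↦ ?_, fun hdr hr2 ↦ ?_, fun hr2 hrd ↦ ?_⟩
    · rw [SubspaceCode.cdcRate_eq_zero h, EReal.coe_zero]
    · rw [SubspaceCode.cdcRate_of_le_half hdr hr2]
    · rw [SubspaceCode.cdcRate_of_half_le hr2 hrd]
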